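/- Let $\mathrm{AP}$ be a finite set of atomic propositions. A trace over $\mathrm{AP}$ is an infinite sequence $t = t(0)t(1)t(2)\cdots$ of subsets of $\mathrm{AP}$. A HyperLTL formula over $\mathrm{AP}$ consists of a prefix of quantifiers $\exists \pi$, $\forall \pi$ over trace variables $\pi$, followed by a quantifier-free formula built from atomic formulas $a_\pi$ ($a \in \mathrm{AP}$, $\pi$ a trace variable) with Boolean connectives and the temporal operators $\mathbf{X}$ (next), $\mathbf{U}$ (until), $\mathbf{F}$ (eventually) and $\mathbf{G}$ (always). It is a sentence if every trace variable in it is bound. A set $T$ of traces is a model of a sentence $\varphi$ if $\varphi$ is true when its quantifiers range over $T$, the quantifier-free part is evaluated as in linear temporal logic, synchronously along all quantified traces from position $0$ on, and $a_\pi$ holds at position $j$ if $a \in t(j)$ for the trace $t$ assigned to $\pi$. The sentence $\varphi$ is satisfiable if it has a nonempty model. The temporal depth of $\varphi$ is the maximal nesting depth of its temporal operators. Theorem. The following problem is undecidable: given a finite set $\mathrm{AP}$ and a HyperLTL sentence $\varphi$ over $\mathrm{AP}$ of the form $\forall \pi_1 \forall \pi_2 \exists \pi_3 \cdots \exists \pi_{m}.\,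 \psi$ (two universal quantifiers, followed by an arbitrary number, possibly zero, of existential ones, with $\psi$ quantifier-free) that has temporal depth one and uses only $\mathbf{F}$ and $\mathbf{G}$ as temporal operators, is $\varphi$ satisfiable? -/

import Mathlib

namespace HyperLTL

/-- A trace over `AP`: an infinite sequence of valuations (subsets of `AP`). -/
abbrev Trace (AP : Type) : Type := ℕ → Set AP

/-- The suffix `t(j) t(j+1) t(j+2) ⋯` of a trace. -/
def Trace.suffix {AP : Type} (t : Trace AP) (j : ℕ) : Trace AP := fun k => t (j + k)

/-- Quantifier-free formulas over the atomic propositions `AP`. Trace variables are natural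
numbers; `atom a π` is the atomic formula `a_π`. -/
inductive Body (AP : Type) : Type where
  | atom (a : AP) (π : ℕ) : Body AP
  | neg (ψ : Body AP) : Body AP
  | disj (ψ χ : Body AP) : Body AP
  | conj (ψ χ : Body AP) : Body AP
  | next (ψ : Body AP) : Body AP
  | untl (ψ χ : Body AP) : Body AP
  | eventually (ψ : Body AP) : Body AP
  | always (ψ : Body AP) : Body AP

/-- Formulas of HyperLTL: a block of trace quantifiers followed by a quantifier-free formula. -/
inductive Formula (AP : Type) : Type where
  | ex (π : ℕ) (φ : Formula AP) : Formula AP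
  | all (π : ℕ) (φ : Formula AP) : Formula AP
  | body (ψ : Body AP) : Formula AP

/-- A trace assignment: a partial map from trace variables to traces. -/
abbrev Assignment (AP : Type) : Type := ℕ → Option (Trace AP)

/-- The assignment with empty domain. -/
def Assignment.empty (AP : Type) : Assignment AP := fun _ => none

/-- The assignment `Π[π → t]`. -/
def Assignment.set {AP : Type} (A : Assignment AP) (π : ℕ) (t : Trace AP) : Assignment AP :=
  Function.update A π (some t)

/-- All traces of the assignment are replaced by their suffix from position `j` on. -/
def Assignment.suffix {AP : Type} (A : Assignment AP) (j : ℕ) : Assignment AP :=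
  fun π => (A π).map fun t => t.suffix j

/-- Satisfaction of quantifier-free formulas. -/
def Body.Sat {AP : Type} : Assignment AP → Body AP → Prop
  | A, .atom a π => ∃ t, A π = some t ∧ a ∈ t 0
  | A, .neg ψ => ¬ ψ.Sat A
  | A, .disj ψ χ => ψ.Sat A ∨ χ.Sat A
  | A, .conj ψ χ => ψ.Sat A ∧ χ.Sat A
  | A, .next ψ => ψ.Sat (A.suffix 1)
  | A, .untl ψ χ => ∃ j, χ.Sat (A.suffix j) ∧ ∀ j' < j, ψ.Sat (A.suffix j')
  | A, .eventually ψ => ∃ j, ψ.Sat (A.suffix j)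
  | A, .always ψ => ∀ j, ψ.Sat (A.suffix j)

/-- Satisfaction `(T, Π) ⊨ φ`: the quantifiers range over the traces in `T`. -/
def Formula.Sat {AP : Type} (T : Set (Trace AP)) : Assignment AP → Formula AP → Prop
  | A, .ex π φ => ∃ t ∈ T, φ.Sat T (A.set π t)
  | A, .all π φ => ∀ t ∈ T, φ.Sat T (A.set π t)
  | A, .body ψ => ψ.Sat A

/-- A formula is satisfiable if it has a nonempty model. -/
def Formula.Satisfiable {AP : Type} (φ : Formula AP) : Prop :=
  ∃ T : Set (Trace AP), T.Nonempty ∧ φ.Sat T (Assignment.empty AP)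

/-- The trace variables of a quantifier-free formula. -/
def Body.vars {AP : Type} : Body AP → Finset ℕ
  | .atom _ π => {π}
  | .neg ψ => ψ.vars
  | .disj ψ χ => ψ.vars ∪ χ.vars
  | .conj ψ χ => ψ.vars ∪ χ.vars
  | .next ψ => ψ.vars
  | .untl ψ χ => ψ.vars ∪ χ.vars
  | .eventually ψ => ψ.vars
  | .always ψ => ψ.vars

/-- The free trace variables of a formula. -/
def Formula.freeVars {AP : Type} : Formula AP → Finset ℕ
  | .ex π φ => φ.freeVars.erase π
  | .all π φ => φ.freeVars.erase π
  | .body ψ => ψ.vars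

/-- A sentence is a formula without free trace variables. -/
def Formula.IsSentence {AP : Type} (φ : Formula AP) : Prop := φ.freeVars = ∅

/-- The temporal depth of a quantifier-free formula: nesting depth of temporal operators. -/
def Body.temporalDepth {AP : Type} : Body AP → ℕ
  | .atom _ _ => 0
  | .neg ψ => ψ.temporalDepth
  | .disj ψ χ => max ψ.temporalDepth χ.temporalDepth
  | .conj ψ χ => max ψ.temporalDepth χ.temporalDepth
  | .next ψ => 1 + ψ.temporalDepth
  | .untl ψ χ => 1 + max ψ.temporalDepth χ.temporalDepth
  | .eventually ψ => 1 + ψ.temporalDepth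
  | .always ψ => 1 + ψ.temporalDepth

/-- The temporal depth of a formula. -/
def Formula.temporalDepth {AP : Type} : Formula AP → ℕ
  | .ex _ φ => φ.temporalDepth
  | .all _ φ => φ.temporalDepth
  | .body ψ => ψ.temporalDepth

/-- No temporal operators other than "eventually" and "always" occur. -/
def Body.OnlyFG {AP : Type} : Body AP → Prop
  | .atom _ _ => True
  | .neg ψ => ψ.OnlyFG
  | .disj ψ χ => ψ.OnlyFG ∧ χ.OnlyFG
  | .conj ψ χ => ψ.OnlyFG ∧ χ.OnlyFG
  | .next _ => False
  | .untl _ _ => False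
  | .eventually ψ => ψ.OnlyFG
  | .always ψ => ψ.OnlyFG

/-- No temporal operators other than "eventually" and "always" occur. -/
def Formula.OnlyFG {AP : Type} : Formula AP → Prop
  | .ex _ φ => φ.OnlyFG
  | .all _ φ => φ.OnlyFG
  | .body ψ => ψ.OnlyFG

/-- The quantifier prefix is `∀²∃*`: two universal quantifiers, followed by any number of
existential ones, and no other quantifiers. -/
def Formula.IsForallTwoExists {AP : Type} (φ : Formula AP) : Prop :=
  ∃ (π₁ π₂ : ℕ) (l : List ℕ) (ψ : Body AP),
    φ = .all π₁ (.all π₂ (l.foldr Formula.ex (.body ψ)))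

/-- A quantifier-free formula over `{0, …, n-1}`, written as a word in Polish notation. -/
def Body.code {n : ℕ} : Body (Fin n) → List ℕ
  | .atom a π => [0, a.val, π]
  | .neg ψ => 1 :: ψ.code
  | .disj ψ χ => 2 :: (ψ.code ++ χ.code)
  | .conj ψ χ => 3 :: (ψ.code ++ χ.code)
  | .next ψ => 4 :: ψ.code
  | .untl ψ χ => 5 :: (ψ.code ++ χ.code)
  | .eventually ψ => 6 :: ψ.code
  | .always ψ => 7 :: ψ.code

/-- A formula over `{0, …, n-1}`, written as a word in Polish notation. -/
def Formula.code {n : ℕ} : Formula (Fin n) → List ℕ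
  | .ex π φ => 8 :: π :: φ.code
  | .all π φ => 9 :: π :: φ.code
  | .body ψ => ψ.code

/-- The word that presents the finite set `AP = {0, …, n-1}` together with a formula over it. -/
def inputWord (n : ℕ) (φ : Formula (Fin n)) : List ℕ := n :: φ.code

theorem Body.code_append_inj {n : ℕ} (ψ : Body (Fin n)) :
    ∀ (χ : Body (Fin n)) (r s : List ℕ), ψ.code ++ r = χ.code ++ s → ψ = χ ∧ r = s := by
  induction ψ with
  | atom a π =>
    intro χ r s h
    cases χ <;> simp_all [Body.code, Fin.ext_iff]
  | neg ψ ih | next ψ ih | eventually ψ ih | always ψ ih =>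
    intro χ r s h
    cases χ <;> simp [Body.code] at h
    obtain ⟨h1, h2⟩ := ih _ _ _ h
    exact ⟨by rw [h1], h2⟩
  | disj ψ ψ' ih ih' | conj ψ ψ' ih ih' | untl ψ ψ' ih ih' =>
    intro χ r s h
    cases χ <;> simp [Body.code] at h
    obtain ⟨h1, h2⟩ := ih _ _ _ h
    obtain ⟨h3, h4⟩ := ih' _ _ _ h2
    exact ⟨by rw [h1, h3], h4⟩

theorem Formula.code_injective {n : ℕ} :
    Function.Injective (Formula.code : Formula (Fin n) → List ℕ) := by
  intro φ
  induction φ with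
  | ex π φ ih | all π φ ih =>
    intro φ' h
    cases φ' with
    | ex | all => simp [Formula.code] at h ⊢ <;> exact ⟨h.1, ih h.2⟩
    | body ψ => cases ψ <;> simp [Formula.code, Body.code] at h
  | body ψ =>
    intro φ' h
    cases φ' with
    | ex | all => cases ψ <;> simp [Formula.code, Body.code] at h
    | body χ =>
      have := (Body.code_append_inj ψ χ [] [] (by simpa [Formula.code] using h)).1
      rw [this]

/-- Different instances are presented by different words. -/
theorem inputWord_inj {n m : ℕ} {φ : Formula (Fin n)} {χ : Formula (Fin m)}
    (h : inputWord n φ = inputWord m χ) : n = m ∧ HEq φ χ := by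
  simp only [inputWord, List.cons.injEq] at h
  obtain ⟨rfl, h⟩ := h
  exact ⟨rfl, heq_of_eq (Formula.code_injective h)⟩

end HyperLTL

/-!
The halting problem is reduced to the satisfiability problem. That the program with number `c`
does not halt on input `0` means that `f (c, k) = 0` for all `k`, for a fixed primitive recursive
function `f` (`exists_primTerm_halting`), and this is what the sentence for `c` says.

Numbers are stored in traces as sets of positions, without using the order of the positions. Each
trace marks a set of positions, its block, with the proposition `blk`. The formula
`F (blk_x ∧ blk_y) → G (blk_x ↔ blk_y)` for all traces `x` and `y`, the only place where two
universal quantifiers are needed, makes two blocks equal or disjoint (`blockRule`). A number `n` is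
a disjoint union of `n` nonempty blocks (`IsNum`). That one stored number is the successor of
another is then expressed with `F` and `G` only, by saying that it is the disjoint union of the
other and a nonempty block (`Body.addAt`).

Some traces are rows of the graphs of the subfunctions of `f`: they store arguments and a value.
For every row `x`, the sentence requires that there are rows that justify it by the defining
equation of the function (`rowRule`); for a composition these are rows of the composed functions,
for a recursion a row with the preceding recursion argument and a row of the step function. By
induction on functions and recursion arguments, every row in a model stores the right value
(`stores_eval`). Further traces store the input `c` and a stage `k`: there is one with `k = 0`, and
for each of them there are a row of `f` for `(c, k)` with value `0` and a trace with stage `k + 1`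
(`searchRule`). Hence `f (c, k) = 0` for all `k` if there is a model
(`eval_eq_zero_of_satisfiable`), and conversely all correct rows, with the blocks `{j}`, form a
model (`satisfiable_of_eval_eq_zero`).

Only the conjunct that the first stage stores `c` depends on the input; it is a chain of `c`
successor conditions (`chain`), so that the sentence is computable from `c`.
-/

namespace HyperLTL

/-! ### Boolean combinations, assignments and prenex sentences -/

/-- The total assignment given by a sequence of traces. -/
def Assignment.ofFun {AP : Type} (w : ℕ → Trace AP) : Assignment AP := fun i => some (w i)

theorem Assignment.suffix_ofFun {AP : Type} (w : ℕ → Trace AP) (j : ℕ) :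
    (Assignment.ofFun w).suffix j = Assignment.ofFun fun i => (w i).suffix j := rfl

/-- The positions at which the proposition `a` holds. -/
def Trace.positions {AP : Type} (t : Trace AP) (a : AP) : Set ℕ := {p | a ∈ t p}

namespace Body

variable {AP AP' : Type}

/-- Material implication. -/
def imp (ψ χ : Body AP) : Body AP := disj (neg ψ) χ

/-- The conjunction of the formulas in `l` and of `ψ`. There is no constant "true", so that a
last conjunct is needed. -/
def conjs (l : List (Body AP)) (ψ : Body AP) : Body AP := l.foldr conj ψ

/-- The boolean equivalence of `a_i` and `ψ`, at all positions. -/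
def alwaysIff (a : AP) (i : ℕ) (ψ : Body AP) : Body AP :=
  always (disj (conj (atom a i) ψ) (conj (neg (atom a i)) (neg ψ)))

/-- `a` holds nowhere on trace `i`. -/
def emptyAt (a : AP) (i : ℕ) : Body AP := always (neg (atom a i))

/-- The positions of `a` on trace `i` are those of `b` on trace `j`. -/
def eqAt (a : AP) (i : ℕ) (b : AP) (j : ℕ) : Body AP := alwaysIff a i (atom b j)

/-- The positions of `a` on trace `i` are the disjoint union of those of `b` on trace `j` and
the nonempty set of those of `s` on trace `u`. -/
def addAt (s : AP) (u : ℕ) (a : AP) (i : ℕ) (b : AP) (j : ℕ) : Body AP :=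
  conj (alwaysIff a i (disj (atom b j) (atom s u)))
    (conj (always (neg (conj (atom b j) (atom s u)))) (eventually (atom s u)))

theorem sat_conj {A : Assignment AP} {ψ χ : Body AP} :
    (conj ψ χ).Sat A ↔ ψ.Sat A ∧ χ.Sat A := Iff.rfl

theorem sat_disj {A : Assignment AP} {ψ χ : Body AP} :
    (disj ψ χ).Sat A ↔ ψ.Sat A ∨ χ.Sat A := Iff.rfl

theorem sat_atom_ofFun {w : ℕ → Trace AP} {a : AP} {i : ℕ} :
    (atom a i).Sat (Assignment.ofFun w) ↔ a ∈ w i 0 := by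
  simp [Sat, Assignment.ofFun]

theorem sat_imp {A : Assignment AP} {ψ χ : Body AP} :
    (imp ψ χ).Sat A ↔ (ψ.Sat A → χ.Sat A) := by
  simp only [imp, Sat]; tauto

theorem sat_conjs {A : Assignment AP} {l : List (Body AP)} {ψ : Body AP} :
    (conjs l ψ).Sat A ↔ (∀ χ ∈ l, χ.Sat A) ∧ ψ.Sat A := by
  induction l with
  | nil => simp [conjs]
  | cons χ l ih =>
    have : (conjs (χ :: l) ψ).Sat A ↔ χ.Sat A ∧ (conjs l ψ).Sat A := Iff.rfl
    rw [this, ih]; simp [and_assoc]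

theorem sat_alwaysIff {w : ℕ → Trace AP} {a : AP} {i : ℕ} {ψ : Body AP} :
    (alwaysIff a i ψ).Sat (Assignment.ofFun w) ↔
      ∀ p, a ∈ w i p ↔ ψ.Sat (Assignment.ofFun fun i => (w i).suffix p) := by
  simp only [alwaysIff, Sat, Assignment.suffix_ofFun]
  refine forall_congr' fun p => ?_
  simp only [Assignment.ofFun, Option.some.injEq, exists_eq_left', Trace.suffix, add_zero]
  tauto

theorem sat_emptyAt {w : ℕ → Trace AP} {a : AP} {i : ℕ} :
    (emptyAt a i).Sat (Assignment.ofFun w) ↔ (w i).positions a = ∅ := by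
  simp [emptyAt, Sat, Assignment.suffix_ofFun, Assignment.ofFun, Trace.suffix,
    Trace.positions, Set.eq_empty_iff_forall_notMem]

theorem sat_eqAt {w : ℕ → Trace AP} {a b : AP} {i j : ℕ} :
    (eqAt a i b j).Sat (Assignment.ofFun w) ↔ (w i).positions a = (w j).positions b := by
  simp [eqAt, sat_alwaysIff, sat_atom_ofFun, Trace.suffix, Trace.positions, Set.ext_iff]

theorem sat_addAt {w : ℕ → Trace AP} {s a b : AP} {u i j : ℕ} :
    (addAt s u a i b j).Sat (Assignment.ofFun w) ↔
      (w i).positions a = (w j).positions b ∪ (w u).positions s ∧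
      Disjoint ((w j).positions b) ((w u).positions s) ∧ ((w u).positions s).Nonempty := by
  simp [addAt, Sat, sat_alwaysIff, Assignment.suffix_ofFun, Assignment.ofFun, Trace.suffix,
    Trace.positions, Set.ext_iff, Set.disjoint_left, Set.Nonempty]

/-- Boolean combinations of formulas without temporal operators and of `F β`, `G β` with `β`
free of them. -/
def Flat (ψ : Body AP) : Prop := ψ.OnlyFG ∧ ψ.temporalDepth ≤ 1

theorem Flat.conj {ψ χ : Body AP} (h : ψ.Flat) (h' : χ.Flat) : (conj ψ χ).Flat :=
  ⟨⟨h.1, h'.1⟩, max_le h.2 h'.2⟩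

theorem Flat.disj {ψ χ : Body AP} (h : ψ.Flat) (h' : χ.Flat) : (disj ψ χ).Flat :=
  ⟨⟨h.1, h'.1⟩, max_le h.2 h'.2⟩

theorem Flat.imp {ψ χ : Body AP} (h : ψ.Flat) (h' : χ.Flat) : (imp ψ χ).Flat :=
  ⟨⟨h.1, h'.1⟩, max_le h.2 h'.2⟩

theorem flat_atom {a : AP} {i : ℕ} : (atom a i).Flat := ⟨trivial, Nat.zero_le _⟩

theorem flat_emptyAt {a : AP} {i : ℕ} : (emptyAt a i).Flat := ⟨trivial, le_rfl⟩

theorem flat_eqAt {a b : AP} {i j : ℕ} : (eqAt a i b j).Flat := by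
  simp [Flat, eqAt, alwaysIff, OnlyFG, temporalDepth]

theorem flat_addAt {s a b : AP} {u i j : ℕ} : (addAt s u a i b j).Flat := by
  simp [Flat, addAt, alwaysIff, OnlyFG, temporalDepth]

theorem flat_conjs {l : List (Body AP)} {ψ : Body AP} (hl : ∀ χ ∈ l, χ.Flat) (h : ψ.Flat) :
    (conjs l ψ).Flat := by
  induction l with
  | nil => exact h
  | cons χ l ih =>
    exact (hl χ (by simp)).conj (ih fun ξ hξ => hl ξ (by simp [hξ]))

/-- Replacement of the atomic propositions. -/
def map (g : AP → AP') : Body AP → Body AP'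
  | atom a π => atom (g a) π
  | neg ψ => neg (ψ.map g)
  | disj ψ χ => disj (ψ.map g) (χ.map g)
  | conj ψ χ => conj (ψ.map g) (χ.map g)
  | next ψ => next (ψ.map g)
  | untl ψ χ => untl (ψ.map g) (χ.map g)
  | eventually ψ => eventually (ψ.map g)
  | always ψ => always (ψ.map g)

/-- The atomic propositions that occur in a formula. -/
def props : Body AP → List AP
  | atom a _ => [a]
  | neg ψ => ψ.props
  | disj ψ χ => ψ.props ++ χ.props
  | conj ψ χ => ψ.props ++ χ.props
  | next ψ => ψ.props
  | untl ψ χ => ψ.props ++ χ.props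
  | eventually ψ => ψ.props
  | always ψ => ψ.props

theorem vars_map (g : AP → AP') (ψ : Body AP) : (ψ.map g).vars = ψ.vars := by
  induction ψ <;> simp_all [map, vars]

theorem temporalDepth_map (g : AP → AP') (ψ : Body AP) :
    (ψ.map g).temporalDepth = ψ.temporalDepth := by
  induction ψ <;> simp_all [map, temporalDepth]

theorem onlyFG_map (g : AP → AP') (ψ : Body AP) : (ψ.map g).OnlyFG ↔ ψ.OnlyFG := by
  induction ψ <;> simp_all [map, OnlyFG]

theorem flat_map {g : AP → AP'} {ψ : Body AP} (h : ψ.Flat) : (ψ.map g).Flat :=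
  ⟨(onlyFG_map g ψ).2 h.1, temporalDepth_map g ψ ▸ h.2⟩

/-- Satisfaction depends only on the variables and propositions that occur in the formula. -/
theorem sat_map_iff (g : AP → AP') (ψ : Body AP) {A' : Assignment AP'} {A : Assignment AP}
    (h : ∀ i ∈ ψ.vars, ∃ t' t, A' i = some t' ∧ A i = some t ∧
      ∀ a ∈ ψ.props, ∀ p, g a ∈ t' p ↔ a ∈ t p) :
    (ψ.map g).Sat A' ↔ ψ.Sat A := by
  have suff : ∀ (ψ : Body AP) (A' : Assignment AP') (A : Assignment AP),
      (∀ i ∈ ψ.vars, ∃ t' t, A' i = some t' ∧ A i = some t ∧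
        ∀ a ∈ ψ.props, ∀ p, g a ∈ t' p ↔ a ∈ t p) → ∀ j, ∀ i ∈ ψ.vars,
      ∃ t' t, A'.suffix j i = some t' ∧ A.suffix j i = some t ∧
        ∀ a ∈ ψ.props, ∀ p, g a ∈ t' p ↔ a ∈ t p := by
    intro ψ A' A h j i hi
    obtain ⟨t', t, h1, h2, h3⟩ := h i hi
    exact ⟨t'.suffix j, t.suffix j, by simp [Assignment.suffix, h1],
      by simp [Assignment.suffix, h2], fun a ha p => h3 a ha _⟩
  have left : ∀ {ψ χ : Body AP} {A' : Assignment AP'} {A : Assignment AP},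
      (∀ i ∈ ψ.vars ∪ χ.vars, ∃ t' t, A' i = some t' ∧ A i = some t ∧
        ∀ a ∈ ψ.props ++ χ.props, ∀ p, g a ∈ t' p ↔ a ∈ t p) → ∀ i ∈ ψ.vars,
      ∃ t' t, A' i = some t' ∧ A i = some t ∧ ∀ a ∈ ψ.props, ∀ p, g a ∈ t' p ↔ a ∈ t p := by
    intro ψ χ A' A h i hi
    obtain ⟨t', t, h1, h2, h3⟩ := h i (Finset.mem_union_left _ hi)
    exact ⟨t', t, h1, h2, fun a ha => h3 a (List.mem_append_left _ ha)⟩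
  have right : ∀ {ψ χ : Body AP} {A' : Assignment AP'} {A : Assignment AP},
      (∀ i ∈ ψ.vars ∪ χ.vars, ∃ t' t, A' i = some t' ∧ A i = some t ∧
        ∀ a ∈ ψ.props ++ χ.props, ∀ p, g a ∈ t' p ↔ a ∈ t p) → ∀ i ∈ χ.vars,
      ∃ t' t, A' i = some t' ∧ A i = some t ∧ ∀ a ∈ χ.props, ∀ p, g a ∈ t' p ↔ a ∈ t p := by
    intro ψ χ A' A h i hi
    obtain ⟨t', t, h1, h2, h3⟩ := h i (Finset.mem_union_right _ hi)
    exact ⟨t', t, h1, h2, fun a ha => h3 a (List.mem_append_right _ ha)⟩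
  induction ψ generalizing A A' with
  | atom a π =>
    obtain ⟨t', t, h1, h2, h3⟩ := h π (by simp [vars])
    simp [map, Sat, h1, h2, h3 a (by simp [props])]
  | neg ψ ih => exact not_congr (ih h)
  | disj ψ χ ih ih' => exact or_congr (ih (left h)) (ih' (right h))
  | conj ψ χ ih ih' => exact and_congr (ih (left h)) (ih' (right h))
  | next ψ ih => exact ih (suff ψ A' A h 1)
  | untl ψ χ ih ih' =>
    exact exists_congr fun j => and_congr (ih' (suff χ A' A (right h) j))
      (forall₂_congr fun j' _ => ih (suff ψ A' A (left h) j'))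
  | eventually ψ ih => exact exists_congr fun j => ih (suff ψ A' A h j)
  | always ψ ih => exact forall_congr' fun j => ih (suff ψ A' A h j)

theorem map_id (ψ : Body AP) : ψ.map id = ψ := by
  induction ψ <;> simp_all [map]

theorem sat_congr {ψ : Body AP} {w : ℕ → Trace AP} {A : Assignment AP}
    (h : ∀ i ∈ ψ.vars, A i = some (w i)) : ψ.Sat A ↔ ψ.Sat (Assignment.ofFun w) := by
  conv_lhs => rw [← ψ.map_id]
  exact sat_map_iff id ψ fun i hi => ⟨w i, w i, h i hi, rfl, fun a _ p => Iff.rfl⟩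

end Body

namespace Formula

variable {AP AP' : Type}

theorem sat_foldr_ex {T : Set (Trace AP)} {φ : Formula AP} {l : List ℕ} {A : Assignment AP} :
    (l.foldr ex φ).Sat T A ↔ ∃ B : Assignment AP, (∀ i ∈ l, ∃ t ∈ T, B i = some t) ∧
      (∀ i ∉ l, B i = A i) ∧ φ.Sat T B := by
  induction l generalizing A with
  | nil =>
    constructor
    · exact fun h => ⟨A, by simp, by simp, h⟩
    · rintro ⟨B, -, h, hB⟩
      have : B = A := funext fun i => h i (by simp)
      exact this ▸ hB
  | cons π l ih =>
    change (∃ t ∈ T, (l.foldr ex φ).Sat T (A.set π t)) ↔ _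
    simp only [ih]
    constructor
    · rintro ⟨t, ht, B, h1, h2, h3⟩
      refine ⟨B, ?_, ?_, h3⟩
      · intro i hi
        by_cases hl : i ∈ l
        · exact h1 i hl
        · have : i = π := by simpa [hl] using hi
          subst this
          exact ⟨t, ht, by simp [h2 i hl, Assignment.set]⟩
      · intro i hi
        simp only [List.mem_cons, not_or] at hi
        simp [h2 i hi.2, Assignment.set, hi.1]
    · rintro ⟨B, h1, h2, h3⟩
      obtain ⟨t, ht, hB⟩ := h1 π (by simp)
      refine ⟨t, ht, B, fun i hi => h1 i (by simp [hi]), ?_, h3⟩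
      intro i hi
      by_cases hπ : i = π
      · subst hπ; simp [hB, Assignment.set]
      · simp [h2 i (by simp [hi, hπ]), Assignment.set, hπ]

/-- The sentence `∀ 0 ∀ 1 ∃ 2 ⋯ ∃ (m + 1). ψ`. -/
def prenex (m : ℕ) (ψ : Body AP) : Formula AP :=
  all 0 (all 1 (((List.range m).map (· + 2)).foldr ex (body ψ)))

theorem sat_prenex {T : Set (Trace AP)} {m : ℕ} {ψ : Body AP}
    (hψ : ∀ i ∈ ψ.vars, i < m + 2) :
    (prenex m ψ).Sat T (Assignment.empty AP) ↔ ∀ x ∈ T, ∀ y ∈ T, ∃ w : ℕ → Trace AP,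
      (∀ i, w i ∈ T) ∧ w 0 = x ∧ w 1 = y ∧ ψ.Sat (Assignment.ofFun w) := by
  refine forall₂_congr fun x hx => forall₂_congr fun y hy => ?_
  rw [sat_foldr_ex]
  have hm : ∀ {i}, i ∈ (List.range m).map (· + 2) ↔ 2 ≤ i ∧ i < m + 2 := by
    intro i
    simp only [List.mem_map, List.mem_range]
    exact ⟨by rintro ⟨a, h, rfl⟩; omega, fun h => ⟨i - 2, by omega, by omega⟩⟩
  constructor
  · rintro ⟨B, h1, h2, h3⟩
    have h0 : B 0 = some x := by
      rw [h2 0 (by rw [hm]; omega)]; simp [Assignment.set]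
    have h1' : B 1 = some y := by
      rw [h2 1 (by rw [hm]; omega)]; simp [Assignment.set]
    have hB : ∀ i < m + 2, ∃ t ∈ T, B i = some t := by
      intro i hi
      rcases i with _ | _ | i
      · exact ⟨x, hx, h0⟩
      · exact ⟨y, hy, h1'⟩
      · exact h1 _ (by rw [hm]; omega)
    -- Variables that are not quantified get the value `x`, as `w` has to be total.
    have hw : ∀ i, ∃ t ∈ T, i < m + 2 → B i = some t := by
      intro i
      by_cases hi : i < m + 2
      · obtain ⟨t, ht, h⟩ := hB i hi
        exact ⟨t, ht, fun _ => h⟩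
      · exact ⟨x, hx, fun h => absurd h hi⟩
    choose w hwT hw using hw
    refine ⟨w, hwT, ?_, ?_, ?_⟩
    · simpa [h0] using (hw 0 (by omega)).symm
    · simpa [h1'] using (hw 1 (by omega)).symm
    · exact (Body.sat_congr fun i hi => hw i (hψ i hi)).1 h3
  · rintro ⟨w, hw, rfl, rfl, h⟩
    refine ⟨fun i => if i < m + 2 then some (w i) else none, ?_, ?_, ?_⟩
    · intro i hi
      exact ⟨w i, hw i, if_pos (hm.1 hi).2⟩
    · intro i hi
      rw [hm] at hi
      rcases i with _ | _ | i
      · simp [Assignment.set]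
      · simp [Assignment.set]
      · have : ¬ i + 1 + 1 < m + 2 := by omega
        simp [Assignment.set, Assignment.empty, this]
    · exact (Body.sat_congr fun i hi => if_pos (hψ i hi)).2 h

/-- Satisfiability is not affected by an injective renaming of the propositions that occur. -/
theorem satisfiable_prenex_map {m : ℕ} {ψ : Body AP} (hψ : ∀ i ∈ ψ.vars, i < m + 2)
    {g : AP → AP'} {h : AP' → AP} (hgh : ∀ a ∈ ψ.props, h (g a) = a) :
    (prenex m (ψ.map g)).Satisfiable ↔ (prenex m ψ).Satisfiable := by
  have hψ' : ∀ i ∈ (ψ.map g).vars, i < m + 2 := by rwa [Body.vars_map]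
  constructor
  · rintro ⟨T, hT, hs⟩
    rw [sat_prenex hψ'] at hs
    refine ⟨(fun t p => {a | g a ∈ t p}) '' T, hT.image _, (sat_prenex hψ).2 ?_⟩
    rintro _ ⟨x, hx, rfl⟩ _ ⟨y, hy, rfl⟩
    obtain ⟨w, hw, rfl, rfl, hs⟩ := hs x hx y hy
    refine ⟨fun i p => {a | g a ∈ w i p}, fun i => ⟨w i, hw i, rfl⟩, rfl, rfl, ?_⟩
    exact (Body.sat_map_iff g ψ fun i _ => ⟨_, _, rfl, rfl, fun a _ p => Iff.rfl⟩).1 hs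
  · rintro ⟨T, hT, hs⟩
    rw [sat_prenex hψ] at hs
    refine ⟨(fun t p => {b | h b ∈ t p}) '' T, hT.image _, (sat_prenex hψ').2 ?_⟩
    rintro _ ⟨x, hx, rfl⟩ _ ⟨y, hy, rfl⟩
    obtain ⟨w, hw, rfl, rfl, hs⟩ := hs x hx y hy
    refine ⟨fun i p => {b | h b ∈ w i p}, fun i => ⟨w i, hw i, rfl⟩, rfl, rfl, ?_⟩
    refine (Body.sat_map_iff g ψ fun i _ => ⟨_, _, rfl, rfl, fun a ha p => ?_⟩).2 hs
    simp [hgh a ha]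

theorem freeVars_foldr_ex (l : List ℕ) (φ : Formula AP) :
    (l.foldr ex φ).freeVars = φ.freeVars \ l.toFinset := by
  induction l with
  | nil => simp
  | cons π l ih =>
    ext i
    simp only [List.foldr_cons, freeVars, ih, Finset.mem_erase, Finset.mem_sdiff,
      List.mem_toFinset, List.mem_cons]
    tauto

theorem isSentence_prenex {m : ℕ} {ψ : Body AP} (hψ : ∀ i ∈ ψ.vars, i < m + 2) :
    (prenex m ψ).IsSentence := by
  simp only [IsSentence, prenex, freeVars, freeVars_foldr_ex, Finset.eq_empty_iff_forall_notMem,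
    Finset.mem_erase, Finset.mem_sdiff, List.mem_toFinset, List.mem_map, List.mem_range]
  rintro i ⟨h0, h1, hi, h⟩
  exact h ⟨i - 2, by have := hψ i hi; omega, by omega⟩

theorem isForallTwoExists_prenex (m : ℕ) (ψ : Body AP) : (prenex m ψ).IsForallTwoExists :=
  ⟨0, 1, _, ψ, rfl⟩

theorem onlyFG_prenex {m : ℕ} {ψ : Body AP} (h : ψ.OnlyFG) : (prenex m ψ).OnlyFG := by
  change (((List.range m).map (· + 2)).foldr ex (body ψ)).OnlyFG
  induction (List.range m).map (· + 2) with
  | nil => exact h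
  | cons π l ih => exact ih

theorem temporalDepth_prenex (m : ℕ) (ψ : Body AP) :
    (prenex m ψ).temporalDepth = ψ.temporalDepth := by
  change (((List.range m).map (· + 2)).foldr ex (body ψ)).temporalDepth = _
  induction (List.range m).map (· + 2) with
  | nil => rfl
  | cons π l ih => exact ih

theorem code_prenex {n : ℕ} (m : ℕ) (ψ : Body (Fin n)) :
    (prenex m ψ).code = 9 :: 0 :: 9 :: 1 :: ((List.range m).flatMap (fun i => [8, i + 2]) ++
      ψ.code) := by
  have : ∀ l : List ℕ, ((l.map (· + 2)).foldr ex (body ψ)).code =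
      l.flatMap (fun i => [8, i + 2]) ++ ψ.code := by
    intro l
    induction l with
    | nil => rfl
    | cons i l ih => simp [code, ← ih]
  simp [prenex, code, this]

end Formula

/-! ### Numbers as sets of blocks -/

/-- `IsNum C S n`: the set `S` is the union of `n` pairwise disjoint nonempty sets from `C`. -/
inductive IsNum (C : Set (Set ℕ)) : Set ℕ → ℕ → Prop
  | zero : IsNum C ∅ 0
  | succ {S B : Set ℕ} {n : ℕ} : IsNum C S n → B ∈ C → B.Nonempty → Disjoint S B →
      IsNum C (S ∪ B) (n + 1)

namespace IsNum

variable {C : Set (Set ℕ)} {S B : Set ℕ} {n : ℕ}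

theorem eq_zero (h : IsNum C S n) (hS : S = ∅) : n = 0 := by
  cases h with
  | zero => rfl
  | succ _ _ hB _ => exact absurd (Set.union_empty_iff.1 hS).2 hB.ne_empty

/-- If any two sets in `C` that meet are equal, then a block that lies in a number is one of the
blocks of which the number is made up, so that removing it gives the predecessor. -/
theorem pred (hC : ∀ B ∈ C, ∀ B' ∈ C, (B ∩ B').Nonempty → B = B') (h : IsNum C (S ∪ B) n)
    (hBC : B ∈ C) (hB : B.Nonempty) (hSB : Disjoint S B) : ∃ m, n = m + 1 ∧ IsNum C S m := by
  generalize hU : S ∪ B = U at h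
  induction h generalizing S with
  | zero => exact absurd (Set.union_empty_iff.1 hU).2 hB.ne_empty
  | @succ S' B' k h hB'C hB' hd ih =>
    -- Either `B` is the block that was added last, or it lies in the part `S'` before that.
    by_cases hBB : B = B'
    · subst hBB
      refine ⟨k, rfl, ?_⟩
      have : S = S' := by
        rw [← hSB.sup_sdiff_cancel_right, ← hd.sup_sdiff_cancel_right]
        exact congrArg (· \ B) hU
      rwa [this]
    · have hdis : Disjoint B B' := by
        rw [Set.disjoint_iff_inter_eq_empty]
        by_contra hne
        exact hBB (hC B hBC B' hB'C (Set.nonempty_iff_ne_empty.2 hne))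
      have hS' : (S \ B') ∪ B = S' := by
        ext p
        have h1 := Set.ext_iff.1 hU p
        have h2 : p ∈ B → p ∉ B' := fun h => Set.disjoint_left.1 hdis h
        have h3 : p ∈ S' → p ∉ B' := fun h => Set.disjoint_left.1 hd h
        simp only [Set.mem_union, Set.mem_sdiff] at h1 ⊢
        tauto
      obtain ⟨m, rfl, hm⟩ := ih (hSB.mono_left Set.sdiff_subset) hS'
      refine ⟨m + 1, rfl, ?_⟩
      have hS : S = (S \ B') ∪ B' := by
        ext p
        have h1 := Set.ext_iff.1 hU p
        have h2 : p ∈ B → p ∉ B' := fun h => Set.disjoint_left.1 hdis h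
        simp only [Set.mem_union, Set.mem_sdiff] at h1 ⊢
        tauto
      rw [hS]
      exact hm.succ hB'C hB' Set.disjoint_sdiff_left

end IsNum

/-! ### Terms for primitive recursive functions -/

/-- Terms for primitive recursive functions, by arity. -/
inductive PrimTerm : ℕ → Type
  | zero : PrimTerm 0
  | succ : PrimTerm 1
  | get {n : ℕ} (i : Fin n) : PrimTerm n
  | comp {m n : ℕ} (f : PrimTerm n) (g : Fin n → PrimTerm m) : PrimTerm m
  | prec {n : ℕ} (f : PrimTerm n) (g : PrimTerm (n + 2)) : PrimTerm (n + 1)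

namespace PrimTerm

/-- The function computed by a term. -/
def eval : {n : ℕ} → PrimTerm n → (Fin n → ℕ) → ℕ
  | _, zero, _ => 0
  | _, succ, v => v 0 + 1
  | _, get i, v => v i
  | _, comp f g, v => f.eval fun i => (g i).eval v
  | _, prec f g, v => Nat.rec (f.eval fun i => v i.succ)
      (fun y r => g.eval (Fin.cons y (Fin.cons r fun i => v i.succ))) (v 0)

/-- The subterms of a term. -/
def subterms : {n : ℕ} → PrimTerm n → List (Σ n, PrimTerm n)
  | _, zero => [⟨_, zero⟩]
  | _, succ => [⟨_, succ⟩]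
  | _, get i => [⟨_, get i⟩]
  | _, comp f g => ⟨_, comp f g⟩ :: (f.subterms ++ (List.ofFn fun i => (g i).subterms).flatten)
  | _, prec f g => ⟨_, prec f g⟩ :: (f.subterms ++ g.subterms)

theorem exists_eval_eq {n : ℕ} {f : List.Vector ℕ n → ℕ} (hf : Nat.Primrec' f) :
    ∃ k : PrimTerm n, ∀ v, k.eval v = f (List.Vector.ofFn v) := by
  induction hf with
  | zero => exact ⟨zero, fun _ => rfl⟩
  | succ => exact ⟨succ, fun v => rfl⟩
  | get i => exact ⟨get i, fun v => by simp [eval]⟩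
  | comp g _ _ ihf ihg =>
    obtain ⟨kf, hkf⟩ := ihf
    choose kg hkg using ihg
    exact ⟨comp kf kg, fun v => by simp [eval, hkf, hkg]⟩
  | prec _ _ ihf ihg =>
    obtain ⟨kf, hkf⟩ := ihf
    obtain ⟨kg, hkg⟩ := ihg
    refine ⟨prec kf kg, fun v => ?_⟩
    simp only [eval, hkf, hkg]
    rfl

end PrimTerm

/-! ### The sentences -/

/-- The atomic propositions. A trace at whose first position `kind k` holds is a row of the graph
of the function computed by `k`, with its arguments stored in the propositions `arg j` and its
value in `out`; a trace that starts with `search` stores an input and a stage of the search in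
`arg 0` and `arg 1`. The set of positions of `blk` is the block of a trace. -/
inductive Prp : Type
  | blk
  | out
  | arg (j : ℕ)
  | search
  | kind {n : ℕ} (k : PrimTerm n)

open Body Prp

/-- The condition for trace `0` to be a row of the graph of `k`. Trace `2` supplies a block, and
the traces from `4` on are rows that are used to justify trace `0`. -/
def rowRule : {n : ℕ} → PrimTerm n → Body Prp
  | _, .zero => emptyAt out 0
  | _, .succ => addAt blk 2 out 0 (arg 0) 0
  | _, .get i => eqAt out 0 (arg i) 0
  | m, .comp (n := n) f g =>
    conjs (List.ofFn fun i : Fin n =>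
        conjs (List.ofFn fun j : Fin m => eqAt (arg j) (i + 5) (arg j) 0)
          (conj (atom (kind (g i)) (i + 5)) (eqAt (arg i) 4 out (i + 5))))
      (conj (atom (kind f) 4) (eqAt out 0 out 4))
  | _, .prec (n := n) f g =>
    disj
      (conjs (List.ofFn fun j : Fin n => eqAt (arg j) 4 (arg (j + 1)) 0)
        (conj (emptyAt (arg 0) 0) (conj (atom (kind f) 4) (eqAt out 0 out 4))))
      (conjs (List.ofFn fun j : Fin n => conj (eqAt (arg (j + 1)) 4 (arg (j + 1)) 0)
          (eqAt (arg (j + 2)) 5 (arg (j + 1)) 0))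
        (conj (conj (addAt blk 2 (arg 0) 0 (arg 0) 4) (atom (kind (.prec f g)) 4))
          (conj (conj (atom (kind g) 5) (eqAt (arg 0) 5 (arg 0) 4))
            (conj (eqAt (arg 1) 5 out 4) (eqAt out 0 out 5)))))

/-- If trace `0` stores input `c` and stage `k`, then `f (c, k) = 0`, as witnessed by trace `4`,
and trace `5` stores input `c` and stage `k + 1`. -/
def searchRule (f : PrimTerm 2) : Body Prp :=
  conj (conj (conj (atom (kind f) 4) (emptyAt out 4))
      (conj (eqAt (arg 0) 4 (arg 0) 0) (eqAt (arg 1) 4 (arg 1) 0)))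
    (conj (atom search 5) (conj (eqAt (arg 0) 5 (arg 0) 0) (addAt blk 2 (arg 1) 5 (arg 1) 0)))

/-- Blocks that meet are equal. -/
def blockRule : Body Prp :=
  imp (eventually (conj (atom blk 0) (atom blk 1))) (eqAt blk 0 blk 1)

/-- The part of the sentence that does not depend on the input. Trace `3` starts the search. -/
def core (f : PrimTerm 2) : Body Prp :=
  conj blockRule
    (conj (conj (atom search 3) (emptyAt (arg 1) 3))
      (conjs (f.subterms.map fun k => imp (atom (kind k.2) 0) (rowRule k.2))
        (imp (atom search 0) (searchRule f))))

/-- The traces `r, …, r + c` store the numbers `0, …, c`. -/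
def chain (r : ℕ) : ℕ → Body Prp
  | 0 => emptyAt (arg 0) r
  | c + 1 => conj (addAt blk (r + c) (arg 0) (r + c + 1) (arg 0) (r + c)) (chain r c)

/-- The first trace variable that is used neither for a rule nor for the start of the search. -/
def chainStart (f : PrimTerm 2) : ℕ := (core f).vars.sup id + 4

/-- The quantifier-free part of the sentence that states that `f (c, k) = 0` for all `k`. -/
def matrix (f : PrimTerm 2) (c : ℕ) : Body Prp :=
  conj (core f) (conj (eqAt (arg 0) 3 (arg 0) (chainStart f + c)) (chain (chainStart f) c))

theorem flat_rowRule {n : ℕ} (k : PrimTerm n) : (rowRule k).Flat := by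
  cases k with
  | zero => exact flat_emptyAt
  | succ => exact flat_addAt
  | get i => exact flat_eqAt
  | comp f g =>
    refine flat_conjs ?_ (flat_atom.conj flat_eqAt)
    simp only [List.forall_mem_ofFn_iff]
    refine fun i => flat_conjs ?_ (flat_atom.conj flat_eqAt)
    simp only [List.forall_mem_ofFn_iff]
    exact fun _ => flat_eqAt
  | prec f g =>
    refine (flat_conjs ?_ (flat_emptyAt.conj (flat_atom.conj flat_eqAt))).disj
      (flat_conjs ?_ ((flat_addAt.conj flat_atom).conj
        ((flat_atom.conj flat_eqAt).conj (flat_eqAt.conj flat_eqAt))))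
    · simp only [List.forall_mem_ofFn_iff]
      exact fun _ => flat_eqAt
    · simp only [List.forall_mem_ofFn_iff]
      exact fun _ => flat_eqAt.conj flat_eqAt

theorem flat_chain (r c : ℕ) : (chain r c).Flat := by
  induction c with
  | zero => exact flat_emptyAt
  | succ c ih => exact flat_addAt.conj ih

theorem flat_core (f : PrimTerm 2) : (core f).Flat := by
  refine Flat.conj ?_ ((flat_atom.conj flat_emptyAt).conj (flat_conjs ?_ ?_))
  · exact Flat.imp ⟨by simp [OnlyFG], by simp [temporalDepth]⟩ flat_eqAt
  · simp only [List.mem_map]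
    rintro _ ⟨k, -, rfl⟩
    exact flat_atom.imp (flat_rowRule _)
  · exact flat_atom.imp (((flat_atom.conj flat_emptyAt).conj (flat_eqAt.conj flat_eqAt)).conj
      (flat_atom.conj (flat_eqAt.conj flat_addAt)))

theorem flat_matrix (f : PrimTerm 2) (c : ℕ) : (matrix f c).Flat :=
  (flat_core f).conj (flat_eqAt.conj (flat_chain _ _))

theorem one_le_temporalDepth_matrix (f : PrimTerm 2) (c : ℕ) :
    1 ≤ (matrix f c).temporalDepth :=
  le_max_of_le_left (le_max_of_le_left (le_max_of_le_left (Nat.le_add_right 1 _)))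

theorem lt_chainStart {f : PrimTerm 2} {i : ℕ} (hi : i ∈ (core f).vars) : i < chainStart f := by
  have := Finset.le_sup (f := id) hi
  simp only [id_eq] at this
  unfold chainStart; omega

theorem vars_chain {r c i : ℕ} (hi : i ∈ (chain r c).vars) : i ≤ r + c := by
  induction c with
  | zero => simp_all [chain, emptyAt, vars]
  | succ c ih =>
    simp only [chain, vars, addAt, alwaysIff, Finset.mem_union, Finset.mem_singleton] at hi
    rcases hi with hi | hi
    · omega
    · have := ih hi; omega

theorem vars_matrix {f : PrimTerm 2} {c i : ℕ} (hi : i ∈ (matrix f c).vars) :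
    i < chainStart f + c + 2 := by
  simp only [matrix, vars, eqAt, alwaysIff, Finset.mem_union, Finset.mem_singleton] at hi
  have h4 : 4 ≤ chainStart f := Nat.le_add_left _ _
  rcases hi with hi | hi | hi
  · have := lt_chainStart hi; omega
  · omega
  · have := vars_chain hi; omega

theorem props_matrix {f : PrimTerm 2} {c : ℕ} {a : Prp} (ha : a ∈ (matrix f c).props) :
    a ∈ arg 0 :: blk :: (core f).props := by
  have hc : ∀ r, ∀ a ∈ (chain r c).props, a = arg 0 ∨ a = blk := by
    intro r
    clear ha
    induction c with
    | zero => simp [chain, emptyAt, props]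
    | succ c ih =>
      intro a ha
      simp only [chain, props, addAt, alwaysIff, List.mem_append, List.mem_singleton] at ha
      rcases ha with ha | ha
      · tauto
      · exact ih a ha
  simp only [matrix, props, eqAt, alwaysIff, List.mem_append, List.mem_singleton] at ha
  rcases ha with ha | ha | ha
  · simp [ha]
  · have : a = arg 0 := by tauto
    simp [this]
  · rcases hc _ a ha with rfl | rfl <;> simp

/-! ### Models describe computations -/

section Soundness

variable {T : Set (Trace Prp)}

/-- The blocks of the traces in `T`. -/
def blocks (T : Set (Trace Prp)) : Set (Set ℕ) := (Trace.positions · blk) '' T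

/-- A trace in `T` with `kind k` is justified by traces in `T`. -/
def RowRuleHolds (T : Set (Trace Prp)) {n : ℕ} (k : PrimTerm n) : Prop :=
  ∀ x ∈ T, kind k ∈ x 0 → ∃ w : ℕ → Trace Prp, (∀ i, w i ∈ T) ∧ w 0 = x ∧
    (rowRule k).Sat (Assignment.ofFun w)

/-- The trace `x` stores the number `n` in the proposition `a`. -/
abbrev Stores (T : Set (Trace Prp)) (x : Trace Prp) (a : Prp) (n : ℕ) : Prop :=
  IsNum (blocks T) (x.positions a) n

theorem Stores.succ {x y u : Trace Prp} {a b : Prp} {n : ℕ} (h : Stores T x a n) (hu : u ∈ T)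
    (hy : y.positions b = x.positions a ∪ u.positions blk ∧
      Disjoint (x.positions a) (u.positions blk) ∧ (u.positions blk).Nonempty) :
    Stores T y b (n + 1) := by
  rw [Stores, hy.1]
  exact IsNum.succ h ⟨u, hu, rfl⟩ hy.2.2 hy.2.1

theorem Stores.pred (hT : ∀ B ∈ blocks T, ∀ B' ∈ blocks T, (B ∩ B').Nonempty → B = B')
    {x y u : Trace Prp} {a b : Prp} {n : ℕ} (h : Stores T y b n) (hu : u ∈ T)
    (hy : y.positions b = x.positions a ∪ u.positions blk ∧
      Disjoint (x.positions a) (u.positions blk) ∧ (u.positions blk).Nonempty) :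
    ∃ m, n = m + 1 ∧ Stores T x a m := by
  rw [Stores, hy.1] at h
  exact h.pred hT ⟨u, hu, rfl⟩ hy.2.2 hy.2.1

/-- A row whose arguments are numbers stores the value of the function. The proof is by induction
on the term and, for a recursion, on the recursion argument, which is a union of finitely many
blocks and loses one of them in the justifying row. -/
theorem stores_eval (hT : ∀ B ∈ blocks T, ∀ B' ∈ blocks T, (B ∩ B').Nonempty → B = B')
    {n : ℕ} (k : PrimTerm n) (hk : ∀ k' ∈ k.subterms, RowRuleHolds T k'.2)
    {x : Trace Prp} (hx : x ∈ T) (hkx : kind k ∈ x 0) {v : Fin n → ℕ}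
    (hv : ∀ i : Fin n, Stores T x (arg i) (v i)) : Stores T x out (k.eval v) := by
  induction k generalizing x with
  | zero =>
    obtain ⟨w, hw, rfl, h⟩ := hk ⟨_, .zero⟩ (by simp [PrimTerm.subterms]) x hx hkx
    rw [rowRule, sat_emptyAt] at h
    rw [Stores, h]
    exact IsNum.zero
  | succ =>
    obtain ⟨w, hw, rfl, h⟩ := hk ⟨_, .succ⟩ (by simp [PrimTerm.subterms]) x hx hkx
    rw [rowRule, sat_addAt] at h
    exact (hv 0).succ (hw 2) h
  | get i =>
    obtain ⟨w, hw, rfl, h⟩ := hk ⟨_, .get i⟩ (by simp [PrimTerm.subterms]) x hx hkx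
    rw [rowRule, sat_eqAt] at h
    rw [Stores, h]
    exact hv i
  | comp f g ihf ihg =>
    obtain ⟨w, hw, rfl, h⟩ := hk ⟨_, .comp f g⟩ (by simp [PrimTerm.subterms]) x hx hkx
    simp only [rowRule, sat_conjs, List.forall_mem_ofFn_iff, sat_conj, sat_eqAt,
      sat_atom_ofFun] at h
    obtain ⟨hg, hf, ho⟩ := h
    rw [Stores, ho]
    refine ihf (fun k' hk' => hk k' (by simp [PrimTerm.subterms, hk'])) (hw 4) hf fun i => ?_
    obtain ⟨h1, h2, h3⟩ := hg i
    rw [Stores, h3]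
    refine ihg i (fun k' hk' => hk k' ?_) (hw _) h2 fun j => ?_
    · simp only [PrimTerm.subterms, List.mem_cons, List.mem_append, List.mem_flatten,
        List.mem_ofFn]
      exact Or.inr (Or.inr ⟨_, ⟨i, rfl⟩, hk'⟩)
    · rw [Stores, h1]; exact hv j
  | @prec n f g ihf ihg =>
    have hrule := hk ⟨_, .prec f g⟩ (by simp [PrimTerm.subterms])
    have ihf := @ihf (fun k' hk' => hk k' (by simp [PrimTerm.subterms, hk']))
    have ihg := @ihg (fun k' hk' => hk k' (by simp [PrimTerm.subterms, hk']))
    clear hk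
    obtain ⟨m, hm⟩ : ∃ m, v 0 = m := ⟨_, rfl⟩
    induction m generalizing x v with
    | zero =>
      obtain ⟨w, hw, rfl, h⟩ := hrule x hx hkx
      simp only [rowRule, sat_conjs, List.forall_mem_ofFn_iff, sat_conj, sat_disj, sat_eqAt,
        sat_atom_ofFun, sat_emptyAt, sat_addAt] at h
      rcases h with ⟨h1, -, h2, h3⟩ | ⟨-, ⟨h, -⟩, -⟩
      · rw [Stores, h3]
        simp only [PrimTerm.eval, hm]
        refine ihf (hw 4) h2 fun i => ?_
        rw [Stores, h1]; exact hv i.succ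
      · obtain ⟨m, h, -⟩ := (hv 0).pred hT (hw 2) h
        omega
    | succ m ih =>
      obtain ⟨w, hw, rfl, h⟩ := hrule x hx hkx
      simp only [rowRule, sat_conjs, List.forall_mem_ofFn_iff, sat_conj, sat_disj, sat_eqAt,
        sat_atom_ofFun, sat_emptyAt, sat_addAt] at h
      rcases h with ⟨-, h, -⟩ | ⟨h1, ⟨h2, h3⟩, ⟨h4, h5⟩, h6, h7⟩
      · have := (hv 0).eq_zero h
        omega
      · obtain ⟨m', hm', h0⟩ := (hv 0).pred hT (hw 2) h2
        obtain rfl : m' = m := by omega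
        have hprec := @ih (w 4) (hw 4) h3 (Fin.cons m' fun i => v i.succ) ?_ rfl
        · rw [Stores, h7]
          have : (PrimTerm.prec f g).eval v = g.eval (Fin.cons m' (Fin.cons
              ((PrimTerm.prec f g).eval (Fin.cons m' fun i => v i.succ))
                fun i => v i.succ)) := by
            simp [PrimTerm.eval, hm]
          rw [this]
          refine ihg (hw 5) h4 fun i => ?_
          refine Fin.cases ?_ (fun i => Fin.cases ?_ (fun i => ?_) i) i
          · change IsNum _ (Trace.positions (w 5) (arg 0)) m'
            rw [h5]; exact h0
          · change IsNum _ (Trace.positions (w 5) (arg 1)) _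
            rw [h6]; exact hprec
          · change IsNum _ (Trace.positions (w 5) (arg (i + 2))) (v i.succ)
            rw [(h1 i).2]; exact hv i.succ
        · refine fun i => Fin.cases ?_ (fun i => ?_) i
          · exact h0
          · change IsNum _ (Trace.positions (w 4) (arg (i + 1))) (v i.succ)
            rw [(h1 i).1]; exact hv i.succ

theorem stores_chain {w : ℕ → Trace Prp} (hw : ∀ i, w i ∈ T) {r c : ℕ}
    (h : (chain r c).Sat (Assignment.ofFun w)) : Stores T (w (r + c)) (arg 0) c := by
  induction c with
  | zero =>
    rw [chain, sat_emptyAt] at h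
    rw [Stores, add_zero, h]
    exact IsNum.zero
  | succ c ih =>
    rw [chain, sat_conj, sat_addAt] at h
    exact (ih h.2).succ (hw _) h.1

/-- By induction on `k`, a model contains a trace that stores the input `c` and the stage `k`. -/
theorem eval_eq_zero_of_satisfiable {f : PrimTerm 2} {c m : ℕ}
    (hm : ∀ i ∈ (matrix f c).vars, i < m + 2)
    (h : (Formula.prenex m (matrix f c)).Satisfiable) (k : ℕ) : f.eval ![c, k] = 0 := by
  obtain ⟨T, ⟨t, ht⟩, h⟩ := h
  rw [Formula.sat_prenex hm] at h
  simp only [matrix, core, blockRule, searchRule, sat_conj, sat_imp, sat_conjs, sat_eqAt,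
    sat_emptyAt, sat_addAt, sat_atom_ofFun, List.mem_map, forall_exists_index, and_imp,
    forall_apply_eq_imp_iff₂] at h
  have hT : ∀ B ∈ blocks T, ∀ B' ∈ blocks T, (B ∩ B').Nonempty → B = B' := by
    rintro _ ⟨x, hx, rfl⟩ _ ⟨y, hy, rfl⟩ ⟨p, hp⟩
    obtain ⟨w, -, rfl, rfl, ⟨hb, -⟩, -⟩ := h x hx y hy
    refine hb ⟨p, ?_⟩
    rw [sat_conj, Assignment.suffix_ofFun, sat_atom_ofFun, sat_atom_ofFun]
    exact hp
  have hrow : ∀ k ∈ f.subterms, RowRuleHolds T k.2 := by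
    intro k hk x hx hkx
    obtain ⟨w, hw, rfl, -, ⟨-, -, hr, -⟩, -⟩ := h x hx t ht
    exact ⟨w, hw, rfl, hr k hk hkx⟩
  have key : ∀ k, ∃ x ∈ T, search ∈ x 0 ∧ Stores T x (arg 0) c ∧ Stores T x (arg 1) k := by
    intro k
    induction k with
    | zero =>
      obtain ⟨w, hw, -, -, ⟨-, ⟨hs, h1⟩, -⟩, h0, hc⟩ := h t ht t ht
      refine ⟨w 3, hw 3, hs, ?_, ?_⟩
      · rw [Stores, h0]; exact stores_chain hw hc
      · rw [Stores, h1]; exact IsNum.zero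
    | succ k ih =>
      obtain ⟨x, hx, hs, h0, h1⟩ := ih
      obtain ⟨w, hw, rfl, -, ⟨-, -, -, hr⟩, -⟩ := h x hx t ht
      obtain ⟨-, hs', h0', h1'⟩ := hr hs
      refine ⟨w 5, hw 5, hs', ?_, ?_⟩
      · rw [Stores, h0']; exact h0
      · exact h1.succ (hw 2) h1'
  obtain ⟨x, hx, hs, h0, h1⟩ := key k
  obtain ⟨w, hw, rfl, -, ⟨-, -, -, hr⟩, -⟩ := h x hx t ht
  obtain ⟨⟨⟨hf, ho⟩, h0', h1'⟩, -⟩ := hr hs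
  refine (stores_eval hT f hrow (hw 4) hf (v := ![c, k]) fun i => ?_).eq_zero ho
  refine Fin.cases ?_ (fun i => ?_) i
  · change IsNum _ (Trace.positions (w 4) (arg 0)) c
    rw [h0']; exact h0
  · obtain rfl : i = 0 := Subsingleton.elim _ _
    change IsNum _ (Trace.positions (w 4) (arg 1)) k
    rw [h1']; exact h1

end Soundness

/-! ### Computations give models -/

/-- The trace with the given positions of each proposition. -/
def Trace.ofPositions (S : Prp → Set ℕ) : Trace Prp := fun p => {a | p ∈ S a}

/-- The trace whose block is `{j}`, and which stores `j`. -/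
def numTrace (j : ℕ) : Trace Prp := Trace.ofPositions fun
  | blk => {j}
  | arg 0 => Set.Iio j
  | _ => ∅

/-- The row of the graph of `k` for the arguments `v`. -/
def rowTrace {n : ℕ} (k : PrimTerm n) (v : Fin n → ℕ) : Trace Prp := Trace.ofPositions fun
  | out => Set.Iio (k.eval v)
  | arg j => {p | ∃ h : j < n, p < v ⟨j, h⟩}
  | kind k' => {_p | (⟨_, k'⟩ : Σ n, PrimTerm n) = ⟨n, k⟩}
  | _ => ∅

/-- The trace that stores the input `c` and the stage `k` of the search. -/
def stageTrace (c k : ℕ) : Trace Prp := Trace.ofPositions fun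
  | arg 0 => Set.Iio c
  | arg 1 => Set.Iio k
  | search => Set.univ
  | _ => ∅

/-- The intended model for the input `c`. -/
def intended (c : ℕ) : Set (Trace Prp) :=
  {t | (∃ (n : ℕ) (k : PrimTerm n) (v : Fin n → ℕ), t = rowTrace k v) ∨
    (∃ k, t = stageTrace c k) ∨ ∃ j, t = numTrace j}

theorem rowTrace_mem (c : ℕ) {n : ℕ} (k : PrimTerm n) (v : Fin n → ℕ) :
    rowTrace k v ∈ intended c := Or.inl ⟨n, k, v, rfl⟩

theorem stageTrace_mem (c k : ℕ) : stageTrace c k ∈ intended c := Or.inr (Or.inl ⟨k, rfl⟩)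

theorem numTrace_mem (c j : ℕ) : numTrace j ∈ intended c := Or.inr (Or.inr ⟨j, rfl⟩)

theorem positions_arg_rowTrace {n : ℕ} (k : PrimTerm n) (v : Fin n → ℕ) (i : Fin n) :
    (rowTrace k v).positions (arg i) = Set.Iio (v i) := by
  ext p; exact ⟨fun ⟨_, h⟩ => h, fun h => ⟨i.2, h⟩⟩

theorem positions_arg_zero_rowTrace {n : ℕ} (k : PrimTerm (n + 1)) (v : Fin (n + 1) → ℕ) :
    (rowTrace k v).positions (arg 0) = Set.Iio (v 0) := positions_arg_rowTrace k v 0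

theorem positions_arg_one_rowTrace {n : ℕ} (k : PrimTerm (n + 2)) (v : Fin (n + 2) → ℕ) :
    (rowTrace k v).positions (arg 1) = Set.Iio (v 1) := positions_arg_rowTrace k v 1

theorem positions_arg_succ_rowTrace {n : ℕ} (k : PrimTerm (n + 1)) (v : Fin (n + 1) → ℕ)
    (i : Fin n) : (rowTrace k v).positions (arg (i + 1)) = Set.Iio (v i.succ) :=
  positions_arg_rowTrace k v i.succ

theorem positions_arg_succ_succ_rowTrace {n : ℕ} (k : PrimTerm (n + 2)) (v : Fin (n + 2) → ℕ)
    (i : Fin n) : (rowTrace k v).positions (arg (i + 2)) = Set.Iio (v i.succ.succ) :=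
  positions_arg_rowTrace k v i.succ.succ

theorem positions_out_rowTrace {n : ℕ} (k : PrimTerm n) (v : Fin n → ℕ) :
    (rowTrace k v).positions out = Set.Iio (k.eval v) := rfl

theorem positions_blk_numTrace (j : ℕ) : (numTrace j).positions blk = {j} := rfl

theorem positions_arg_numTrace (j : ℕ) : (numTrace j).positions (arg 0) = Set.Iio j := rfl

theorem kind_mem_rowTrace {n : ℕ} (k : PrimTerm n) (v : Fin n → ℕ) (p : ℕ) :
    kind k ∈ rowTrace k v p := rfl

theorem Iio_succ_eq_add (n : ℕ) : Set.Iio (n + 1) = Set.Iio n ∪ {n} ∧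
    Disjoint (Set.Iio n) {n} ∧ ({n} : Set ℕ).Nonempty := by
  refine ⟨?_, by simp, by simp⟩
  ext p; simp

theorem sat_blockRule_intended {c : ℕ} {w : ℕ → Trace Prp} (h0 : w 0 ∈ intended c)
    (h1 : w 1 ∈ intended c) : blockRule.Sat (Assignment.ofFun w) := by
  rw [blockRule, sat_imp, sat_eqAt]
  rintro ⟨p, hp⟩
  rw [sat_conj, Assignment.suffix_ofFun, sat_atom_ofFun, sat_atom_ofFun] at hp
  change p ∈ (w 0).positions blk ∧ p ∈ (w 1).positions blk at hp
  have key : ∀ t ∈ intended c, p ∈ t.positions blk → t.positions blk = {p} := by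
    rintro t (⟨n, k, v, rfl⟩ | ⟨k, rfl⟩ | ⟨j, rfl⟩) h
    · exact h.elim
    · exact h.elim
    · rw [positions_blk_numTrace, Set.mem_singleton_iff] at h
      rw [positions_blk_numTrace, h]
  rw [key _ h0 hp.1, key _ h1 hp.2]

/-- The sequence `x, y, u, z, ws 0, ws 1, …`. -/
def witnesses (x y u z : Trace Prp) (ws : ℕ → Trace Prp) : ℕ → Trace Prp
  | 0 => x
  | 1 => y
  | 2 => u
  | 3 => z
  | i + 4 => ws i

/-- Traces `1` and `3` do not occur in the rule for rows. -/
theorem sat_rowRule_intended (c : ℕ) {n : ℕ} (k : PrimTerm n) (v : Fin n → ℕ) :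
    ∃ u ∈ intended c, ∃ ws : ℕ → Trace Prp, (∀ i, ws i ∈ intended c) ∧ ∀ y z,
      (rowRule k).Sat (Assignment.ofFun (witnesses (rowTrace k v) y u z ws)) := by
  have hnum : ∀ _ : ℕ, numTrace 0 ∈ intended c := fun _ => numTrace_mem c 0
  cases k with
  | zero =>
    refine ⟨_, hnum 0, fun _ => numTrace 0, hnum, fun y z => ?_⟩
    rw [rowRule, sat_emptyAt]
    change Set.Iio 0 = ∅
    simp
  | succ =>
    refine ⟨_, numTrace_mem c (v 0), fun _ => numTrace 0, hnum, fun y z => ?_⟩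
    rw [rowRule, sat_addAt]
    simp only [witnesses, positions_arg_zero_rowTrace, positions_out_rowTrace,
      positions_blk_numTrace]
    exact Iio_succ_eq_add (v 0)
  | get i =>
    refine ⟨_, hnum 0, fun _ => numTrace 0, hnum, fun y z => ?_⟩
    rw [rowRule, sat_eqAt]
    simp only [witnesses, positions_arg_rowTrace, positions_out_rowTrace]
    rfl
  | @comp _ n f g =>
    refine ⟨_, hnum 0, fun
      | 0 => rowTrace f fun i => (g i).eval v
      | i + 1 => if h : i < n then rowTrace (g ⟨i, h⟩) v else numTrace 0, ?_, fun y z => ?_⟩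
    · rintro (_ | i)
      · exact rowTrace_mem _ _ _
      · dsimp only
        split
        · exact rowTrace_mem _ _ _
        · exact numTrace_mem _ _
    · simp only [rowRule, sat_conjs, List.forall_mem_ofFn_iff, sat_conj, sat_eqAt,
        sat_atom_ofFun, witnesses, Fin.is_lt, dif_pos, positions_arg_rowTrace,
        positions_out_rowTrace, kind_mem_rowTrace, Fin.eta, PrimTerm.eval, implies_true,
        and_true]
  | @prec n f g =>
    rcases hv : v 0 with _ | m
    · refine ⟨_, hnum 0, fun _ => rowTrace f fun i => v i.succ,
        fun _ => rowTrace_mem _ _ _, fun y z => ?_⟩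
      simp only [rowRule, sat_conjs, List.forall_mem_ofFn_iff, sat_conj, sat_disj, sat_eqAt,
        sat_atom_ofFun, sat_emptyAt, witnesses]
      refine Or.inl ⟨fun i => ?_, ?_, kind_mem_rowTrace _ _ _, ?_⟩
      · rw [positions_arg_rowTrace, positions_arg_succ_rowTrace]
      · rw [positions_arg_zero_rowTrace, hv]; simp
      · rw [positions_out_rowTrace, positions_out_rowTrace, PrimTerm.eval, hv]
        rfl
    · set v' : Fin (n + 1) → ℕ := Fin.cons m fun i => v i.succ with hv'
      refine ⟨_, numTrace_mem c m, fun
        | 0 => rowTrace (.prec f g) v'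
        | _ => rowTrace g (Fin.cons m (Fin.cons ((PrimTerm.prec f g).eval v')
            fun i => v i.succ)), ?_, fun y z => ?_⟩
      · rintro (_ | i)
        · exact rowTrace_mem _ _ _
        · exact rowTrace_mem _ _ _
      · simp only [rowRule, sat_conjs, List.forall_mem_ofFn_iff, sat_conj, sat_disj, sat_eqAt,
          sat_atom_ofFun, sat_addAt, witnesses]
        refine Or.inr ⟨fun i => ⟨?_, ?_⟩, ⟨?_, kind_mem_rowTrace _ _ _⟩,
          ⟨kind_mem_rowTrace _ _ _, ?_⟩, ?_, ?_⟩
        · rw [positions_arg_succ_rowTrace, positions_arg_succ_rowTrace]; rfl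
        · rw [positions_arg_succ_succ_rowTrace, positions_arg_succ_rowTrace]; rfl
        · rw [positions_arg_zero_rowTrace, positions_arg_zero_rowTrace, positions_blk_numTrace,
            hv]
          exact Iio_succ_eq_add m
        · rw [positions_arg_zero_rowTrace, positions_arg_zero_rowTrace]; rfl
        · rw [positions_arg_one_rowTrace, positions_out_rowTrace]; rfl
        · rw [positions_out_rowTrace, positions_out_rowTrace, PrimTerm.eval, hv]
          simp [PrimTerm.eval, hv']

theorem sat_core_intended {f : PrimTerm 2} {c : ℕ} (hf : ∀ k, f.eval ![c, k] = 0)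
    {x y : Trace Prp} (hx : x ∈ intended c) (hy : y ∈ intended c) :
    ∃ u ∈ intended c, ∃ ws : ℕ → Trace Prp, (∀ i, ws i ∈ intended c) ∧
      (core f).Sat (Assignment.ofFun (witnesses x y u (stageTrace c 0) ws)) := by
  have hinit : ∀ u ws, search ∈ witnesses x y u (stageTrace c 0) ws 3 0 ∧
      (witnesses x y u (stageTrace c 0) ws 3).positions (arg 1) = ∅ := by
    refine fun u ws => ⟨trivial, ?_⟩
    change Set.Iio 0 = ∅
    simp
  have hb : ∀ u ws, blockRule.Sat (Assignment.ofFun (witnesses x y u (stageTrace c 0) ws)) :=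
    fun u ws => sat_blockRule_intended hx hy
  simp only [core, sat_conj, sat_conjs, sat_imp, sat_emptyAt, sat_atom_ofFun, List.mem_map,
    forall_exists_index, and_imp, forall_apply_eq_imp_iff₂, hb, true_and]
  rcases hx with ⟨n, k, v, rfl⟩ | ⟨k, rfl⟩ | ⟨j, rfl⟩
  · obtain ⟨u, hu, ws, hws, h⟩ := sat_rowRule_intended c k v
    refine ⟨u, hu, ws, hws, hinit u ws, ?_, fun h => h.elim⟩
    rintro ⟨n', k'⟩ - hk'
    have hk' : (⟨n', k'⟩ : Σ n, PrimTerm n) = ⟨n, k⟩ := hk'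
    cases hk'
    exact h _ _
  · refine ⟨_, numTrace_mem c k, fun
      | 0 => rowTrace f ![c, k]
      | _ => stageTrace c (k + 1), ?_, hinit _ _, fun _ _ h => h.elim, fun _ => ?_⟩
    · rintro (_ | i)
      · exact rowTrace_mem _ _ _
      · exact stageTrace_mem _ _
    · simp only [searchRule, sat_conj, sat_eqAt, sat_emptyAt, sat_addAt, sat_atom_ofFun,
        witnesses]
      refine ⟨⟨⟨kind_mem_rowTrace _ _ _, ?_⟩, ?_, ?_⟩, trivial, rfl, ?_⟩
      · rw [positions_out_rowTrace, hf]; simp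
      · rw [positions_arg_zero_rowTrace]; rfl
      · rw [positions_arg_one_rowTrace]; rfl
      · exact Iio_succ_eq_add k
  · exact ⟨_, numTrace_mem c 0, fun _ => numTrace 0, fun _ => numTrace_mem c 0, hinit _ _,
      fun _ _ h => h.elim, fun h => h.elim⟩

theorem sat_chain_numTrace {w : ℕ → Trace Prp} {r : ℕ} (hw : ∀ i, w (r + i) = numTrace i)
    (c : ℕ) : (chain r c).Sat (Assignment.ofFun w) := by
  induction c with
  | zero =>
    have := hw 0
    rw [add_zero] at this
    rw [chain, sat_emptyAt, this, positions_arg_numTrace]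
    simp
  | succ c ih =>
    rw [chain, sat_conj, sat_addAt, add_assoc, hw, hw, positions_arg_numTrace,
      positions_arg_numTrace, positions_blk_numTrace]
    exact ⟨Iio_succ_eq_add c, ih⟩

/-- The traces from `chainStart f` on are chosen to be the stored numbers `0, 1, …`. -/
theorem satisfiable_of_eval_eq_zero {f : PrimTerm 2} {c m : ℕ}
    (hm : ∀ i ∈ (matrix f c).vars, i < m + 2) (hf : ∀ k, f.eval ![c, k] = 0) :
    (Formula.prenex m (matrix f c)).Satisfiable := by
  refine ⟨intended c, ⟨_, numTrace_mem c 0⟩, (Formula.sat_prenex hm).2 fun x hx y hy => ?_⟩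
  obtain ⟨u, hu, ws, hws, h⟩ := sat_core_intended hf hx hy
  have h4 : 4 ≤ chainStart f := Nat.le_add_left _ _
  set w₀ := witnesses x y u (stageTrace c 0) ws with hw₀
  set w : ℕ → Trace Prp := fun i =>
    if i < chainStart f then w₀ i else numTrace (i - chainStart f) with hw
  have hlow : ∀ i < chainStart f, w i = w₀ i := fun i hi => if_pos hi
  have hhigh : ∀ i, w (chainStart f + i) = numTrace i := fun i => by simp [hw]
  refine ⟨w, fun i => ?_, hlow 0 (by omega), hlow 1 (by omega), ?_, ?_, ?_⟩
  · by_cases hi : i < chainStart f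
    · rw [hlow i hi]
      rcases i with _ | _ | _ | _ | i
      · exact hx
      · exact hy
      · exact hu
      · exact stageTrace_mem c 0
      · exact hws i
    · obtain ⟨j, rfl⟩ := Nat.exists_eq_add_of_le (not_lt.1 hi)
      rw [hhigh]
      exact numTrace_mem c j
  · refine (sat_congr fun i hi => ?_).2 h
    rw [Assignment.ofFun, hlow i (lt_chainStart hi)]
  · rw [sat_eqAt, hlow 3 (by omega), hhigh, positions_arg_numTrace]
    rfl
  · exact sat_chain_numTrace hhigh c

/-! ### The sentences are computable from the input -/

section Primrec

variable {n : ℕ}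

/-- The formula `ψ c` is primitive recursive in `c`. -/
def PrimrecCode (ψ : ℕ → Body (Fin n)) : Prop := Primrec fun c => (ψ c).code

namespace PrimrecCode

variable {ψ χ : ℕ → Body (Fin n)}

theorem atom (a : Fin n) {v : ℕ → ℕ} (hv : Primrec v) : PrimrecCode fun c => .atom a (v c) :=
  Primrec.list_cons.comp (Primrec.const 0) (Primrec.list_cons.comp (Primrec.const a.val)
    (Primrec.list_cons.comp hv (Primrec.const [])))

theorem neg (h : PrimrecCode ψ) : PrimrecCode fun c => .neg (ψ c) :=
  Primrec.list_cons.comp (Primrec.const 1) h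

theorem disj (h : PrimrecCode ψ) (h' : PrimrecCode χ) : PrimrecCode fun c => .disj (ψ c) (χ c) :=
  Primrec.list_cons.comp (Primrec.const 2) (Primrec.list_append.comp h h')

theorem conj (h : PrimrecCode ψ) (h' : PrimrecCode χ) : PrimrecCode fun c => .conj (ψ c) (χ c) :=
  Primrec.list_cons.comp (Primrec.const 3) (Primrec.list_append.comp h h')

theorem eventually (h : PrimrecCode ψ) : PrimrecCode fun c => .eventually (ψ c) :=
  Primrec.list_cons.comp (Primrec.const 6) h

theorem always (h : PrimrecCode ψ) : PrimrecCode fun c => .always (ψ c) :=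
  Primrec.list_cons.comp (Primrec.const 7) h

theorem const (ψ : Body (Fin n)) : PrimrecCode fun _ => ψ := Primrec.const ψ.code

theorem alwaysIff (a : Fin n) {v : ℕ → ℕ} (hv : Primrec v) (h : PrimrecCode ψ) :
    PrimrecCode fun c => .alwaysIff a (v c) (ψ c) :=
  (((atom a hv).conj h).disj ((atom a hv).neg.conj h.neg)).always

theorem addAt (s a b : Fin n) {u v v' : ℕ → ℕ} (hu : Primrec u) (hv : Primrec v)
    (hv' : Primrec v') : PrimrecCode fun c => .addAt s (u c) a (v c) b (v' c) :=
  (alwaysIff a hv ((atom b hv').disj (atom s hu))).conj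
    (((atom b hv').conj (atom s hu)).neg.always.conj (atom s hu).eventually)

theorem chain (g : Prp → Fin n) (r : ℕ) : PrimrecCode fun c => (chain r c).map g := by
  have hr : Primrec fun c => r + c := Primrec.nat_add.comp (Primrec.const r) Primrec.id
  have hadd := addAt (g blk) (g (arg 0)) (g (arg 0)) hr (Primrec.succ.comp hr) hr
  refine (Primrec.nat_rec₁ (((HyperLTL.chain r 0).map g).code)
    (f := fun c l => 3 :: ((Body.addAt (g blk) (r + c) (g (arg 0)) (r + c + 1) (g (arg 0))
      (r + c)).code ++ l)) ?_).of_eq fun c => ?_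
  · exact Primrec.list_cons.comp (Primrec.const 3)
      (Primrec.list_append.comp (hadd.comp Primrec.fst) Primrec.snd)
  · induction c with
    | zero => rfl
    | succ c ih => simp only [ih]; rfl

theorem matrix (g : Prp → Fin n) (f : PrimTerm 2) : PrimrecCode fun c => (matrix f c).map g :=
  (const ((core f).map g)).conj ((alwaysIff (g (arg 0)) (Primrec.const 3)
    (atom (g (arg 0)) (Primrec.nat_add.comp (Primrec.const _) Primrec.id))).conj (chain g _))

theorem inputWord_prenex (h : PrimrecCode ψ) {m : ℕ → ℕ} (hm : Primrec m) :
    Primrec fun c => inputWord n (Formula.prenex (m c) (ψ c)) := by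
  simp only [inputWord, Formula.code_prenex]
  have hpre : Primrec fun c => (List.range (m c)).flatMap fun i => [8, i + 2] :=
    Primrec.list_flatMap (Primrec.list_range.comp hm)
      (Primrec.list_cons.comp (Primrec.const 8)
        (Primrec.list_cons.comp (Primrec.succ.comp (Primrec.succ.comp Primrec.snd))
          (Primrec.const [])))
  have hcons : ∀ (a : ℕ) {F : ℕ → List ℕ}, Primrec F → Primrec fun c => a :: F c :=
    fun a F hF => Primrec.list_cons.comp (Primrec.const a) hF
  exact hcons _ (hcons _ (hcons _ (hcons _ (hcons _ (Primrec.list_append.comp hpre h)))))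

end PrimrecCode

end Primrec

/-- Finitely many propositions can be renamed injectively to `0, …, n - 1`. -/
theorem exists_renaming {AP : Type} (l : List AP) (hl : l ≠ []) :
    ∃ (n : ℕ) (g : AP → Fin n) (h : Fin n → AP), ∀ a ∈ l, h (g a) = a := by
  have : ∀ a, ∃ i : Fin l.length, a ∈ l → l.get i = a := by
    intro a
    by_cases ha : a ∈ l
    · obtain ⟨i, hi⟩ := List.get_of_mem ha
      exact ⟨i, fun _ => hi⟩
    · exact ⟨⟨0, List.length_pos_iff.2 hl⟩, fun h => absurd h ha⟩
  choose g hg using this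
  exact ⟨l.length, g, l.get, hg⟩

/-- A term whose zeros `(c, k)` are the stages `k` at which the program with number `c`, run on
`0`, has not halted yet. -/
theorem exists_primTerm_halting : ∃ f : PrimTerm 2, ∀ c : Nat.Partrec.Code,
    (∀ k, f.eval ![Encodable.encode c, k] = 0) ↔ ¬ (c.eval 0).Dom := by
  have hprim : Primrec₂ fun c k : ℕ => Encodable.encode
      (Nat.Partrec.Code.evaln k (Denumerable.ofNat Nat.Partrec.Code c) 0) :=
    Primrec.encode.comp (Nat.Partrec.Code.primrec_evaln.comp (Primrec.pair
      (Primrec.pair Primrec.snd ((Primrec.ofNat _).comp Primrec.fst)) (Primrec.const 0)))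
  obtain ⟨f, hf⟩ := PrimTerm.exists_eval_eq (Nat.Primrec'.prim_iff₂.2 hprim)
  refine ⟨f, fun c => ?_⟩
  have hval : ∀ k, f.eval ![Encodable.encode c, k] =
      Encodable.encode (Nat.Partrec.Code.evaln k c 0) := by
    intro k
    rw [hf]
    change Encodable.encode (Nat.Partrec.Code.evaln k
      (Denumerable.ofNat Nat.Partrec.Code (Encodable.encode c)) 0) = _
    rw [Denumerable.ofNat_encode]
  simp only [hval]
  rw [Part.dom_iff_mem]
  simp only [Nat.Partrec.Code.evaln_complete, not_exists]
  constructor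
  · intro h x k hx
    have := h k
    rw [Option.mem_def.1 hx, Encodable.encode_some] at this
    omega
  · intro h k
    rw [Option.eq_none_iff_forall_not_mem.2 fun x => h x k, Encodable.encode_none]

end HyperLTL

open HyperLTL in
/-- There is no algorithm that, given a finite set `AP = {0, …, n-1}` and a `∀²∃*` HyperLTL
sentence over `AP` of temporal depth one that uses only "eventually" and "always" as temporal
operators, decides whether the sentence is satisfiable. -/
theorem theorem5 :
    ¬ ∃ f : List ℕ → Bool, Computable f ∧
      ∀ (n : ℕ) (φ : HyperLTL.Formula (Fin n)),
        φ.IsSentence → φ.IsForallTwoExists → φ.OnlyFG → φ.temporalDepth = 1 →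
          (f (HyperLTL.inputWord n φ) = true ↔ φ.Satisfiable) := by
  rintro ⟨d, hd, hdec⟩
  obtain ⟨f, hf⟩ := HyperLTL.exists_primTerm_halting
  obtain ⟨n, g, h, hgh⟩ := exists_renaming (.arg 0 :: .blk :: (core f).props) (by simp)
  have hvars : ∀ c, ∀ i ∈ (matrix f c).vars, i < chainStart f + c + 2 := fun c i => vars_matrix
  have hspec : ∀ c : Nat.Partrec.Code, d (inputWord n (Formula.prenex
      (chainStart f + Encodable.encode c) ((matrix f (Encodable.encode c)).map g))) = true ↔
        ¬ (c.eval 0).Dom := by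
    intro c
    generalize hc : Encodable.encode c = c'
    have hflat := Body.flat_map (g := g) (flat_matrix f c')
    have hdepth : ((matrix f c').map g).temporalDepth = 1 :=
      le_antisymm hflat.2 (Body.temporalDepth_map g _ ▸ one_le_temporalDepth_matrix f c')
    rw [hdec n _ (Formula.isSentence_prenex (by rw [Body.vars_map]; exact hvars c'))
      (Formula.isForallTwoExists_prenex _ _) (Formula.onlyFG_prenex hflat.1)
      (by rw [Formula.temporalDepth_prenex, hdepth]),
      Formula.satisfiable_prenex_map (hvars c') fun a ha => hgh a (props_matrix ha), ← hf, hc]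
    exact ⟨eval_eq_zero_of_satisfiable (hvars c'), satisfiable_of_eval_eq_zero (hvars c')⟩
  have hcomp : Computable fun c : Nat.Partrec.Code => d (inputWord n (Formula.prenex
      (chainStart f + Encodable.encode c) ((matrix f (Encodable.encode c)).map g))) :=
    hd.comp ((PrimrecCode.inputWord_prenex (PrimrecCode.matrix g f)
      (Primrec.nat_add.comp (Primrec.const (chainStart f)) Primrec.id)).to_comp.comp
        Computable.encode)
  have hnot : ComputablePred fun c : Nat.Partrec.Code => ¬ (c.eval 0).Dom :=
    ComputablePred.computable_iff.2 ⟨_, hcomp, funext fun c => propext (hspec c).symm⟩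
  exact ComputablePred.halting_problem_not_re 0 hnot.to_re
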